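/- Let $\mathbb T$ be the unit circle with angular coordinate $\theta$ modulo $2\pi$ and arc length $d\theta$, let $\Omega=\mathbb T\times(0,1)$ with points $z=(\theta,r)$ and measure $dz=d\theta\,dr$, and let $\Gamma=\mathbb T\times\{1\}$. Let $\alpha\in[1,2)$, $w=r^\alpha$ and $A=\operatorname{diag}(1,r^\alpha)$. Gradients $\nabla=(\partial_\theta,\partial_r)$ and divergences are taken in the sense of distributions on $\Omega$. Define $$H(\operatorname{div},\Omega;w^{-1})=\Big\{\mathbf u\in[L^2(\Omega)]^2:\ \int_\Omega \mathbf u\cdot A^{-1}\mathbf u\,dz<\infty,\ \operatorname{div}\mathbf u\in L^2(\Omega)\Big\},$$ $$H^1(\Omega;w)=\Big\{v\in L^2(\Omega):\ \int_\Omega\nabla v\cdot A\nabla v\,dz<\infty\Big\},\qquad \|v\|_{H^1(\Omega;w)}^2=\int_\Omega(\nabla v\cdot A\nabla v+v^2)\,dz,$$ and let $H^1_\Gamma(\Omega;w)$ be the closure in $H^1(\Omega;w)$ of the set of all $\varphi\in C^\infty(\overline\Omega)$ whose support has positive distance from $\Gamma$. Theorem 2.14. For every $\mathbf u\in H(\operatorname{div},\Omega;w^{-1})$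 and every $v\in H^1_\Gamma(\Omega;w)$, the function $[\operatorname{div}\mathbf u]\,v+\mathbf u\cdot\nabla v$ is integrable on $\Omega$ and $$\int_\Omega\big([\operatorname{div}\mathbf u]\,v+\mathbf u\cdot\nabla v\big)\,dz=0.$$ -/

import Mathlib

open MeasureTheory Matrix
open scoped Real ContDiff ENNReal

noncomputable section

namespace Cylinder

/-- The circle `𝕋`, parametrised by the angle `θ` modulo `2π`; its volume is arc length (total
mass `2π`). -/
abbrev Circ : Type := AddCircle (2 * π)

instance fact_two_pi_pos : Fact (0 < 2 * π) := ⟨Real.two_pi_pos⟩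

/-- Points `z = (θ, r)` of the infinite cylinder `𝕋 × ℝ`, with the product measure `dz = dθ dr`. -/
abbrev Pt : Type := Circ × ℝ

/-- `Ω = 𝕋 × (0, 1)`. -/
def Om : Set Pt := Set.univ ×ˢ Set.Ioo (0 : ℝ) 1

/-- The closure `𝕋 × [0, 1]` of `Ω`. -/
def OmBar : Set Pt := Set.univ ×ˢ Set.Icc (0 : ℝ) 1

/-- The upper boundary circle `Γ = 𝕋 × {1}`. -/
def Gam : Set Pt := Set.univ ×ˢ {(1 : ℝ)}

/-- The matrix `A = diag(1, r ^ α)` at height `r`. -/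
def A (α r : ℝ) : Matrix (Fin 2) (Fin 2) ℝ := Matrix.diagonal ![1, r ^ α]

/-- A function on the cylinder read in the coordinates `(θ, r) ∈ ℝ × ℝ`, hence `2π`-periodic
in `θ`. -/
def lift (f : Pt → ℝ) (p : ℝ × ℝ) : ℝ := f ((p.1 : Circ), p.2)

/-- The classical gradient `(∂_θ f, ∂_r f)`. -/
def grad (f : Pt → ℝ) (z : Pt) : Fin 2 → ℝ :=
  ![deriv (fun t : ℝ => f (z.1 + (t : Circ), z.2)) 0, deriv (fun s : ℝ => f (z.1, s)) z.2]

/-- `C₀^∞(Ω)`: smooth functions whose support is compact and contained in `Ω`. -/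
def testFunctions : Set (Pt → ℝ) :=
  {ψ | ContDiff ℝ ∞ (lift ψ) ∧ HasCompactSupport ψ ∧ tsupport ψ ⊆ Om}

/-- `g` is the gradient of `v` on `Ω` in the sense of distributions (component `0` is the
`θ`-derivative, component `1` the `r`-derivative). -/
structure IsWeakGrad (v : Pt → ℝ) (g : Pt → Fin 2 → ℝ) : Prop where
  locInt : LocallyIntegrableOn v Om volume
  grad_locInt : ∀ i, LocallyIntegrableOn (fun z => g z i) Om volume
  integral_eq : ∀ ψ ∈ testFunctions, ∀ i,
    ∫ z in Om, g z i * ψ z = -∫ z in Om, v z * grad ψ z i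

/-- `d` is the divergence of the vector field `u` on `Ω` in the sense of distributions. -/
structure IsWeakDiv (u : Pt → Fin 2 → ℝ) (d : Pt → ℝ) : Prop where
  locInt : ∀ i, LocallyIntegrableOn (fun z => u z i) Om volume
  div_locInt : LocallyIntegrableOn d Om volume
  integral_eq : ∀ ψ ∈ testFunctions,
    ∫ z in Om, d z * ψ z = -∫ z in Om, u z ⬝ᵥ grad ψ z

/-- `H(div, Ω; w⁻¹)` with `w = r ^ α`: fields `u ∈ [L²(Ω)]²` such that `u · A⁻¹ u` is integrable
and the distributional divergence lies in `L²(Ω)`. -/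
def HDivW (α : ℝ) : Set (Pt → Fin 2 → ℝ) :=
  {u | (∀ i, MemLp (fun z => u z i) 2 (volume.restrict Om)) ∧
    IntegrableOn (fun z => u z ⬝ᵥ ((A α z.2)⁻¹ *ᵥ u z)) Om volume ∧
    ∃ d : Pt → ℝ, IsWeakDiv u d ∧ MemLp d 2 (volume.restrict Om)}

/-- `H¹(Ω; w)` with `w = r ^ α`: functions `v ∈ L²(Ω)` with a distributional gradient such that
`∇v · A ∇v` is integrable. -/
def H1W (α : ℝ) : Set (Pt → ℝ) :=
  {v | MemLp v 2 (volume.restrict Om) ∧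
    ∃ g : Pt → Fin 2 → ℝ, IsWeakGrad v g ∧
      IntegrableOn (fun z => g z ⬝ᵥ (A α z.2 *ᵥ g z)) Om volume}

/-- The square `∫_Ω (∇v · A ∇v + v²) dz` of the norm of `H¹(Ω; w)`, for `v` with distributional
gradient `g`. -/
def H1WNormSq (α : ℝ) (v : Pt → ℝ) (g : Pt → Fin 2 → ℝ) : ℝ≥0∞ :=
  ∫⁻ z in Om, ENNReal.ofReal (g z ⬝ᵥ (A α z.2 *ᵥ g z) + v z ^ 2)

/-- `C_Γ^∞(Ω)`: functions smooth up to the boundary of `Ω` whose support (in the closure of `Ω`)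
has positive distance from `Γ`. -/
def CGam : Set (Pt → ℝ) :=
  {φ | ContDiffOn ℝ ∞ (lift φ) (Set.univ ×ˢ Set.Icc (0 : ℝ) 1) ∧
    ∃ δ > 0, ∀ z ∈ closure {z | z ∈ OmBar ∧ φ z ≠ 0}, ∀ y ∈ Gam, δ < dist z y}

/-- `H¹_Γ(Ω; w)`: the closure of `C_Γ^∞(Ω)` in `H¹(Ω; w)`. -/
def H1GamW (α : ℝ) : Set (Pt → ℝ) :=
  {v | v ∈ H1W α ∧ ∀ ε > 0, ∃ φ ∈ CGam, ∃ G : Pt → Fin 2 → ℝ,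
    IsWeakGrad (v - φ) G ∧ H1WNormSq α (v - φ) G < ε}

end Cylinder

end

namespace Cylinder

open Set Filter Topology

/-- The covering map `ℝ × ℝ → 𝕋 × ℝ`. -/
noncomputable def cov (p : ℝ × ℝ) : Pt := ((p.1 : Circ), p.2)

lemma lift_apply (f : Pt → ℝ) (p : ℝ × ℝ) : lift f p = f (cov p) := rfl

lemma isOpenQuotientMap_cov : IsOpenQuotientMap cov :=
  (QuotientAddGroup.isOpenQuotientMap_mk (N := AddSubgroup.zmultiples (2 * π))).prodMap
    IsOpenQuotientMap.id

lemma continuous_cov : Continuous cov := isOpenQuotientMap_cov.continuous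

lemma exists_cov_eq (z : Pt) : ∃ p, cov p = z := isOpenQuotientMap_cov.surjective z

lemma cov_eq_cov_iff {p q : ℝ × ℝ} : cov p = cov q ↔ ∃ n : ℤ, p = q + (n * (2 * π), 0) := by
  have key : ((p.1 : Circ) = (q.1 : Circ)) ↔ ∃ n : ℤ, p.1 = q.1 + n * (2 * π) := by
    rw [← sub_eq_zero, ← AddCircle.coe_sub, AddCircle.coe_eq_zero_iff]
    refine exists_congr fun n => ?_
    rw [zsmul_eq_mul]
    constructor <;> intro h <;> linarith
  simp only [cov, Prod.ext_iff, Prod.fst_add, Prod.snd_add, key, add_zero, exists_and_right]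

lemma isOpen_Om : IsOpen Om := isOpen_univ.prod isOpen_Ioo

lemma measurableSet_Om : MeasurableSet Om := isOpen_Om.measurableSet

lemma mem_Om {z : Pt} : z ∈ Om ↔ 0 < z.2 ∧ z.2 < 1 := by simp [Om]

lemma measurePreserving_cov :
    MeasurePreserving cov (volume.restrict (Ioc 0 (2 * π) ×ˢ Ioo (0 : ℝ) 1))
      (volume.restrict Om) := by
  have h1 : MeasurePreserving ((↑) : ℝ → Circ) (volume.restrict (Ioc 0 (2 * π))) volume := by
    simpa using AddCircle.measurePreserving_mk (2 * π) 0
  have h2 := h1.prod (MeasurePreserving.id (volume.restrict (Ioo (0 : ℝ) 1)))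
  have e : (volume : Measure Pt).restrict Om = volume.prod (volume.restrict (Ioo (0 : ℝ) 1)) := by
    rw [Om, Measure.volume_eq_prod, ← Measure.prod_restrict, Measure.restrict_univ]
  rw [e, Measure.volume_eq_prod, ← Measure.prod_restrict]
  exact h2

instance : IsFiniteMeasure ((volume : Measure Pt).restrict Om) := by
  constructor
  rw [Measure.restrict_apply_univ, Om, Measure.volume_eq_prod, Measure.prod_prod]
  exact ENNReal.mul_lt_top (measure_lt_top _ _) (by simp)

lemma integral_Om_eq {f : Pt → ℝ} (hf : AEStronglyMeasurable f (volume.restrict Om)) :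
    ∫ z in Om, f z = ∫ p in Ioc 0 (2 * π) ×ˢ Ioo (0 : ℝ) 1, lift f p := by
  rw [← measurePreserving_cov.map_eq, integral_map measurePreserving_cov.aemeasurable]
  · rfl
  · rwa [measurePreserving_cov.map_eq]

/-- The periodisation of a function on `(0, 2π] × ℝ`. -/
noncomputable def descend (g : ℝ × ℝ → ℝ) (z : Pt) : ℝ := g (AddCircle.equivIoc (2 * π) 0 z.1, z.2)

lemma descend_cov (g : ℝ × ℝ → ℝ) {p : ℝ × ℝ} (hp : p.1 ∈ Ioc 0 (2 * π)) :
    descend g (cov p) = g p := by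
  have : p.1 ∈ Ioc 0 (0 + 2 * π) := by simpa using hp
  have h := AddCircle.equivIoc_coe_of_mem (p := 2 * π) (a := 0) this
  simp only [descend, cov, h]

lemma descend_mem_testFunctions {g : ℝ × ℝ → ℝ} (hg : ContDiff ℝ ∞ g) (hc : HasCompactSupport g)
    (hs : tsupport g ⊆ Ioo 0 (2 * π) ×ˢ Ioo (0 : ℝ) 1) : descend g ∈ testFunctions := by
  have hK : IsCompact (cov '' tsupport g) := hc.isCompact.image continuous_cov
  have hsub : Function.support (descend g) ⊆ cov '' tsupport g := by
    intro z hz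
    refine ⟨(AddCircle.equivIoc (2 * π) 0 z.1, z.2), subset_tsupport _ hz, ?_⟩
    simp [cov, AddCircle.coe_equivIoc]
  have htsub : tsupport (descend g) ⊆ cov '' tsupport g := closure_minimal hsub hK.isClosed
  refine ⟨contDiff_iff_contDiffAt.2 fun p => ?_, HasCompactSupport.intro hK fun z hz => ?_,
    htsub.trans ?_⟩
  · by_cases hp : cov p ∈ cov '' tsupport g
    · obtain ⟨k, hk, hkp⟩ := hp
      obtain ⟨n, hn⟩ := cov_eq_cov_iff.1 hkp
      have hcd : ContDiffAt ℝ ∞ (fun q : ℝ × ℝ => g (q + (n * (2 * π), 0))) p :=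
        (hg.comp (contDiff_id.add contDiff_const)).contDiffAt
      refine hcd.congr_of_eventuallyEq ?_
      have hcont : ContinuousAt (fun q : ℝ × ℝ => q + ((n : ℝ) * (2 * π), (0 : ℝ))) p := by
        fun_prop
      have hnhds : Ioo 0 (2 * π) ×ˢ Ioo (0 : ℝ) 1 ∈ 𝓝 (p + ((n : ℝ) * (2 * π), (0 : ℝ))) :=
        (isOpen_Ioo.prod isOpen_Ioo).mem_nhds (hn ▸ hs hk)
      filter_upwards [hcont.preimage_mem_nhds hnhds] with q hq
      have hq1 : (q + ((n : ℝ) * (2 * π), (0 : ℝ))).1 ∈ Ioc 0 (2 * π) :=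
        Ioo_subset_Ioc_self hq.1
      rw [lift_apply, ← descend_cov g hq1]
      congr 1
      exact (cov_eq_cov_iff.2 ⟨n, rfl⟩).symm
    · have : lift (descend g) =ᶠ[𝓝 p] fun _ => 0 := by
        filter_upwards [continuous_cov.continuousAt.preimage_mem_nhds
          (hK.isClosed.isOpen_compl.mem_nhds hp)] with q hq
        exact Function.notMem_support.1 fun h => hq (hsub h)
      exact contDiffAt_const.congr_of_eventuallyEq this
  · exact Function.notMem_support.1 fun h => hz (hsub h)
  · rintro _ ⟨p, hp, rfl⟩
    exact ⟨mem_univ _, (hs hp).2⟩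

lemma continuous_of_mem_testFunctions {ψ : Pt → ℝ} (h : ψ ∈ testFunctions) : Continuous ψ :=
  isOpenQuotientMap_cov.continuous_comp_iff.1 h.1.continuous

lemma integrable_mul_of_tsupport_subset {f ψ : Pt → ℝ} (hf : LocallyIntegrableOn f Om volume)
    (hψ : Continuous ψ) (hc : HasCompactSupport ψ) (hs : tsupport ψ ⊆ Om) :
    IntegrableOn (fun z => f z * ψ z) Om volume := by
  have h1 : IntegrableOn (fun z => f z * ψ z) (tsupport ψ) volume :=
    (hf.integrableOn_compact_subset hs hc.isCompact).mul_continuousOn hψ.continuousOn hc.isCompact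
  have h2 : Integrable (fun z => f z * ψ z) volume :=
    (integrableOn_iff_integrable_of_support_subset
      ((Function.support_mul_subset_right f ψ).trans (subset_tsupport ψ))).1 h1
  exact h2.integrableOn

lemma locallyIntegrableOn_lift {f : Pt → ℝ} (hf : LocallyIntegrableOn f Om volume) :
    LocallyIntegrableOn (lift f) (Ioo 0 (2 * π) ×ˢ Ioo (0 : ℝ) 1) volume := by
  rw [locallyIntegrableOn_iff (isOpen_Ioo.prod isOpen_Ioo).isLocallyClosed]
  intro K hKU hK
  have hK' : IsCompact (cov '' K) := hK.image continuous_cov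
  have hsub : cov '' K ⊆ Om := by
    rintro _ ⟨p, hp, rfl⟩
    exact ⟨mem_univ _, (hKU hp).2⟩
  have hi := hf.integrableOn_compact_subset hsub hK'
  have hmp := measurePreserving_cov.restrict_preimage hK'.isClosed.measurableSet
  rw [Measure.restrict_restrict hK'.isClosed.measurableSet, inter_eq_left.2 hsub] at hmp
  have h := (hmp.integrable_comp hi.aestronglyMeasurable).2 hi
  rw [Measure.restrict_restrict (continuous_cov.measurable hK'.isClosed.measurableSet)] at h
  refine IntegrableOn.mono_set (s := K) h fun p hp => ⟨⟨p, hp, rfl⟩, ?_⟩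
  exact ⟨Ioo_subset_Ioc_self (hKU hp).1, (hKU hp).2⟩

/-- The fundamental lemma of the calculus of variations on the cylinder. -/
lemma ae_eq_zero_of_integral_testFunctions {f : Pt → ℝ} (hf : LocallyIntegrableOn f Om volume)
    (h : ∀ ψ ∈ testFunctions, ∫ z in Om, f z * ψ z = 0) :
    f =ᵐ[volume.restrict Om] 0 := by
  set U : Set (ℝ × ℝ) := Ioo 0 (2 * π) ×ˢ Ioo (0 : ℝ) 1
  have hU : IsOpen U := isOpen_Ioo.prod isOpen_Ioo
  have hUV : U ⊆ Ioc 0 (2 * π) ×ˢ Ioo (0 : ℝ) 1 := prod_mono_left Ioo_subset_Ioc_self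
  have key : ∀ᵐ p ∂(volume : Measure (ℝ × ℝ)), p ∈ U → lift f p = 0 := by
    refine hU.ae_eq_zero_of_integral_contDiff_smul_eq_zero (locallyIntegrableOn_lift hf) ?_
    intro g hg hc hs
    have hψ := descend_mem_testFunctions hg hc hs
    have hi := integrable_mul_of_tsupport_subset hf (continuous_of_mem_testFunctions hψ) hψ.2.1
      hψ.2.2
    have h0 := h _ hψ
    rw [integral_Om_eq hi.aestronglyMeasurable] at h0
    rw [← h0, ← setIntegral_eq_integral_of_forall_compl_eq_zero
      (s := Ioc 0 (2 * π) ×ˢ Ioo (0 : ℝ) 1)]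
    · refine setIntegral_congr_fun (measurableSet_Ioc.prod measurableSet_Ioo) fun p hp => ?_
      simp only [lift_apply, smul_eq_mul, descend_cov g hp.1, mul_comm]
    · intro p hp
      rw [image_eq_zero_of_notMem_tsupport fun hp' => hp (hUV (hs hp')), zero_smul]
  have hae : (Ioc 0 (2 * π) ×ˢ Ioo (0 : ℝ) 1 : Set (ℝ × ℝ)) =ᵐ[volume] U := by
    rw [Measure.volume_eq_prod]
    exact Measure.set_prod_ae_eq Ioo_ae_eq_Ioc.symm (ae_eq_refl _)
  have key2 : ∀ᵐ p ∂(volume.restrict (Ioc 0 (2 * π) ×ˢ Ioo (0 : ℝ) 1) : Measure (ℝ × ℝ)),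
      f (cov p) = 0 := by
    rw [Measure.restrict_congr_set hae, ae_restrict_iff' hU.measurableSet]
    exact key
  have hm : AEMeasurable f (volume.restrict Om) := hf.aestronglyMeasurable.aemeasurable
  rw [← measurePreserving_cov.map_eq] at hm ⊢
  have hmk : ∀ᵐ z ∂(Measure.map cov (volume.restrict (Ioc 0 (2 * π) ×ˢ Ioo (0 : ℝ) 1))),
      hm.mk f z = 0 := by
    rw [ae_map_iff measurePreserving_cov.aemeasurable
      (measurableSet_eq_fun hm.measurable_mk measurable_const)]
    filter_upwards [key2, ae_of_ae_map measurePreserving_cov.aemeasurable hm.ae_eq_mk] with p h1 h2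
    rw [← h2, h1]
  exact hm.ae_eq_mk.trans hmk

/-- Smoothness in the interior of the cylinder. -/
def SmoothOnOm (F : Pt → ℝ) : Prop := ContDiffOn ℝ ∞ (lift F) (univ ×ˢ Ioo (0 : ℝ) 1)

lemma SmoothOnOm.contDiffAt {F : Pt → ℝ} (hF : SmoothOnOm F) {p : ℝ × ℝ} (hp : cov p ∈ Om) :
    ContDiffAt ℝ ∞ (lift F) p :=
  ContDiffOn.contDiffAt hF ((isOpen_univ.prod isOpen_Ioo).mem_nhds ⟨mem_univ _, hp.2⟩)

lemma SmoothOnOm.mul {F G : Pt → ℝ} (hF : SmoothOnOm F) (hG : SmoothOnOm G) :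
    SmoothOnOm (fun z => F z * G z) := ContDiffOn.mul hF hG

lemma smoothOnOm_snd {η : ℝ → ℝ} (hη : ContDiff ℝ ∞ η) : SmoothOnOm (fun z => η z.2) :=
  (hη.comp contDiff_snd).contDiffOn

lemma smoothOnOm_of_mem_testFunctions {ψ : Pt → ℝ} (h : ψ ∈ testFunctions) : SmoothOnOm ψ :=
  h.1.contDiffOn

lemma smoothOnOm_of_mem_CGam {φ : Pt → ℝ} (h : φ ∈ CGam) : SmoothOnOm φ :=
  h.1.mono (prod_mono_right Ioo_subset_Icc_self)

lemma indicator_mem_testFunctions {F : Pt → ℝ} (hF : SmoothOnOm F) {K : Set Pt}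
    (hK : IsCompact K) (hKO : K ⊆ Om) (hs : ∀ z ∈ Om, F z ≠ 0 → z ∈ K) :
    Om.indicator F ∈ testFunctions := by
  have hsub : ∀ z, z ∉ K → Om.indicator F z = 0 := by
    intro z hz
    by_cases hzO : z ∈ Om
    · rw [indicator_of_mem hzO]
      by_contra h
      exact hz (hs z hzO h)
    · exact indicator_of_notMem hzO _
  have hsup : Function.support (Om.indicator F) ⊆ K := fun z hz =>
    by_contra fun h => hz (hsub z h)
  refine ⟨contDiff_iff_contDiffAt.2 fun p => ?_, HasCompactSupport.intro hK hsub,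
    (closure_minimal hsup hK.isClosed).trans hKO⟩
  · by_cases hp : cov p ∈ K
    · refine (hF.contDiffAt (hKO hp)).congr_of_eventuallyEq ?_
      filter_upwards [continuous_cov.continuousAt.preimage_mem_nhds
        (isOpen_Om.mem_nhds (hKO hp))] with q hq
      exact indicator_of_mem (s := Om) (a := cov q) hq F
    · have : lift (Om.indicator F) =ᶠ[𝓝 p] fun _ => 0 := by
        filter_upwards [continuous_cov.continuousAt.preimage_mem_nhds
          (hK.isClosed.isOpen_compl.mem_nhds hp)] with q hq
        exact hsub _ hq
      exact contDiffAt_const.congr_of_eventuallyEq this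

lemma grad_indicator (F : Pt → ℝ) {z : Pt} (hz : z ∈ Om) : grad (Om.indicator F) z = grad F z := by
  have hz2 : ∀ᶠ s in 𝓝 z.2, s ∈ Ioo (0 : ℝ) 1 := isOpen_Ioo.mem_nhds hz.2
  have h1 : (fun t : ℝ => Om.indicator F (z.1 + (t : Circ), z.2)) =
      fun t : ℝ => F (z.1 + (t : Circ), z.2) :=
    funext fun t => indicator_of_mem (s := Om) (a := (z.1 + (t : Circ), z.2)) ⟨mem_univ _, hz.2⟩ F
  have h2 : (fun s : ℝ => Om.indicator F (z.1, s)) =ᶠ[𝓝 z.2] fun s => F (z.1, s) := by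
    filter_upwards [hz2] with s hs
    exact indicator_of_mem (s := Om) (a := (z.1, s)) ⟨mem_univ _, hs⟩ F
  simp only [grad, h1, h2.deriv_eq]

lemma hasDerivAt_lift_fst {F : Pt → ℝ} {p : ℝ × ℝ} (hF : DifferentiableAt ℝ (lift F) p) :
    HasDerivAt (fun t : ℝ => F ((p.1 : Circ) + (t : Circ), p.2)) (fderiv ℝ (lift F) p (1, 0)) 0 := by
  have h : HasDerivAt (fun t : ℝ => ((p.1 + t, p.2) : ℝ × ℝ)) (1, 0) 0 :=
    ((hasDerivAt_id (0 : ℝ)).const_add p.1).prodMk (hasDerivAt_const _ _)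
  have hF' : HasFDerivAt (lift F) (fderiv ℝ (lift F) p) (p.1 + 0, p.2) := by
    simpa using hF.hasFDerivAt
  exact hF'.comp_hasDerivAt (0 : ℝ) h

lemma hasDerivAt_lift_snd {F : Pt → ℝ} {p : ℝ × ℝ} (hF : DifferentiableAt ℝ (lift F) p) :
    HasDerivAt (fun s : ℝ => F ((p.1 : Circ), s)) (fderiv ℝ (lift F) p (0, 1)) p.2 := by
  have h : HasDerivAt (fun s : ℝ => ((p.1, s) : ℝ × ℝ)) (0, 1) p.2 :=
    (hasDerivAt_const _ _).prodMk (hasDerivAt_id p.2)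
  exact hF.hasFDerivAt.comp_hasDerivAt p.2 h

lemma grad_cov {F : Pt → ℝ} {p : ℝ × ℝ} (hF : DifferentiableAt ℝ (lift F) p) :
    grad F (cov p) = ![fderiv ℝ (lift F) p (1, 0), fderiv ℝ (lift F) p (0, 1)] := by
  simp only [grad, cov, (hasDerivAt_lift_fst hF).deriv, (hasDerivAt_lift_snd hF).deriv]

lemma SmoothOnOm.differentiableAt {F : Pt → ℝ} (hF : SmoothOnOm F) {p : ℝ × ℝ} (hp : cov p ∈ Om) :
    DifferentiableAt ℝ (lift F) p := (hF.contDiffAt hp).differentiableAt (by simp)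

lemma SmoothOnOm.grad_mul {F G : Pt → ℝ} (hF : SmoothOnOm F) (hG : SmoothOnOm G) {z : Pt}
    (hz : z ∈ Om) (i : Fin 2) :
    grad (fun z => F z * G z) z i = F z * grad G z i + G z * grad F z i := by
  obtain ⟨p, rfl⟩ := exists_cov_eq z
  have hF' := hF.differentiableAt hz
  have hG' := hG.differentiableAt hz
  have hm : lift (fun z => F z * G z) = lift F * lift G := rfl
  have hFG : DifferentiableAt ℝ (lift fun z => F z * G z) p := by
    rw [hm]
    exact hF'.mul hG'
  rw [grad_cov hF', grad_cov hG', grad_cov hFG, hm, fderiv_mul hF' hG']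
  fin_cases i <;> simp [lift_apply]

lemma grad_snd (η : ℝ → ℝ) (z : Pt) : grad (fun z => η z.2) z = ![0, deriv η z.2] := by
  simp [grad]

lemma continuous_grad {χ : Pt → ℝ} (h : χ ∈ testFunctions) (i : Fin 2) :
    Continuous (fun z => grad χ z i) := by
  refine isOpenQuotientMap_cov.continuous_comp_iff.1 ?_
  have hc : Continuous (fderiv ℝ (lift χ)) := h.1.continuous_fderiv (by simp)
  have hd : Differentiable ℝ (lift χ) := h.1.differentiable (by simp)
  have e : (fun z => grad χ z i) ∘ cov =
      fun p => ![fderiv ℝ (lift χ) p (1, 0), fderiv ℝ (lift χ) p (0, 1)] i :=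
    funext fun p => by rw [Function.comp_apply, grad_cov (hd p)]
  rw [e]
  fin_cases i
  · exact hc.clm_apply continuous_const
  · exact hc.clm_apply continuous_const

lemma integral_grad_eq_zero {χ : Pt → ℝ} (h : χ ∈ testFunctions) (i : Fin 2) :
    ∫ z in Om, grad χ z i = 0 := by
  have hc : Continuous (fderiv ℝ (lift χ)) := h.1.continuous_fderiv (by simp)
  have hd : Differentiable ℝ (lift χ) := h.1.differentiable (by simp)
  rw [integral_Om_eq (continuous_grad h i).aestronglyMeasurable]
  have hcl : Continuous (lift fun z => grad χ z i) := (continuous_grad h i).comp continuous_cov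
  have hint : IntegrableOn (lift fun z => grad χ z i) (Ioc 0 (2 * π) ×ˢ Ioo (0 : ℝ) 1)
      (volume.prod volume) :=
    (hcl.continuousOn.integrableOn_compact (isCompact_Icc.prod isCompact_Icc)).mono_set
      (prod_mono Ioc_subset_Icc_self Ioo_subset_Icc_self)
  have hval : ∀ p, lift (fun z => grad χ z i) p =
      ![fderiv ℝ (lift χ) p (1, 0), fderiv ℝ (lift χ) p (0, 1)] i :=
    fun p => by rw [lift_apply, grad_cov (hd p)]
  fin_cases i
  · rw [Measure.volume_eq_prod, ← setIntegral_prod_swap, setIntegral_prod _ ?_]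
    · refine integral_eq_zero_of_ae (Eventually.of_forall fun s => ?_)
      simp only [Prod.swap_prod_mk, Pi.zero_apply]
      rw [← intervalIntegral.integral_of_le Real.two_pi_pos.le,
        intervalIntegral.integral_eq_sub_of_hasDerivAt (f := fun t => lift χ (t, s))]
      · rw [sub_eq_zero, lift_apply, lift_apply]
        congr 1
        exact cov_eq_cov_iff.2 ⟨1, by simp⟩
      · intro t _
        rw [hval]
        exact (hd (t, s)).hasFDerivAt.comp_hasDerivAt t
          ((hasDerivAt_id t).prodMk (hasDerivAt_const t s))
      · exact (hcl.comp (by fun_prop)).intervalIntegrable _ _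
    · exact (hcl.comp continuous_swap).continuousOn.integrableOn_compact
        (isCompact_Icc.prod isCompact_Icc) |>.mono_set
        (prod_mono Ioo_subset_Icc_self Ioc_subset_Icc_self)
  · rw [Measure.volume_eq_prod, setIntegral_prod _ hint]
    refine integral_eq_zero_of_ae (Eventually.of_forall fun t => ?_)
    simp only [Pi.zero_apply]
    have hz : ∀ z : Pt, z ∉ Om → χ z = 0 := fun z hz =>
      image_eq_zero_of_notMem_tsupport fun h' => hz (h.2.2 h')
    rw [← integral_Ioc_eq_integral_Ioo, ← intervalIntegral.integral_of_le zero_le_one,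
      intervalIntegral.integral_eq_sub_of_hasDerivAt (f := fun s => lift χ (t, s))]
    · rw [lift_apply, lift_apply, hz _ (by simp [Om, cov]), hz _ (by simp [Om, cov]), sub_zero]
    · intro s _
      rw [hval]
      exact (hd (t, s)).hasFDerivAt.comp_hasDerivAt s
        ((hasDerivAt_const s t).prodMk (hasDerivAt_id s))
    · exact (hcl.comp (by fun_prop)).intervalIntegrable _ _

lemma tsupport_grad_subset {χ : Pt → ℝ} (i : Fin 2) :
    tsupport (fun z => grad χ z i) ⊆ tsupport χ := by
  refine closure_minimal (fun z hz => ?_) (isClosed_tsupport χ)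
  by_contra hn
  refine hz ?_
  have h0 : ∀ᶠ y in 𝓝 z, χ y = 0 := by
    filter_upwards [(isClosed_tsupport χ).isOpen_compl.mem_nhds hn] with y hy
    exact image_eq_zero_of_notMem_tsupport hy
  have c1 : Tendsto (fun t : ℝ => ((z.1 + (t : Circ), z.2) : Pt)) (𝓝 0) (𝓝 z) := by
    have hcoe : Continuous ((↑) : ℝ → Circ) := AddCircle.continuous_mk' _
    have : Continuous (fun t : ℝ => ((z.1 + (t : Circ), z.2) : Pt)) := by fun_prop
    simpa using this.tendsto 0
  have c2 : Tendsto (fun s : ℝ => ((z.1, s) : Pt)) (𝓝 z.2) (𝓝 z) := by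
    have : Continuous (fun s : ℝ => ((z.1, s) : Pt)) := by fun_prop
    exact this.tendsto z.2
  have e1 : (fun t : ℝ => χ (z.1 + (t : Circ), z.2)) =ᶠ[𝓝 0] fun _ => 0 := c1.eventually h0
  have e2 : (fun s : ℝ => χ (z.1, s)) =ᶠ[𝓝 z.2] fun _ => 0 := c2.eventually h0
  fin_cases i
  · simpa [grad] using e1.deriv_eq.trans (deriv_const _ _)
  · simpa [grad] using e2.deriv_eq.trans (deriv_const _ _)

lemma integrable_mul_grad {f χ : Pt → ℝ} (hf : LocallyIntegrableOn f Om volume)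
    (h : χ ∈ testFunctions) (i : Fin 2) :
    IntegrableOn (fun z => f z * grad χ z i) Om volume :=
  integrable_mul_of_tsupport_subset hf (continuous_grad h i)
    (h.2.1.of_isClosed_subset (isClosed_tsupport _) (tsupport_grad_subset i))
    ((tsupport_grad_subset i).trans h.2.2)

lemma integrable_mul_testFunction {f χ : Pt → ℝ} (hf : LocallyIntegrableOn f Om volume)
    (h : χ ∈ testFunctions) : IntegrableOn (fun z => f z * χ z) Om volume :=
  integrable_mul_of_tsupport_subset hf (continuous_of_mem_testFunctions h) h.2.1 h.2.2

lemma IsWeakGrad.sub {v w : Pt → ℝ} {g k : Pt → Fin 2 → ℝ} (hv : IsWeakGrad v g)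
    (hw : IsWeakGrad w k) : IsWeakGrad (v - w) (g - k) where
  locInt := hv.locInt.sub hw.locInt
  grad_locInt i := (hv.grad_locInt i).sub (hw.grad_locInt i)
  integral_eq ψ hψ i := by
    simp only [Pi.sub_apply, sub_mul]
    rw [integral_sub (integrable_mul_testFunction (hv.grad_locInt i) hψ)
      (integrable_mul_testFunction (hw.grad_locInt i) hψ),
      integral_sub (integrable_mul_grad hv.locInt hψ i) (integrable_mul_grad hw.locInt hψ i),
      hv.integral_eq ψ hψ i, hw.integral_eq ψ hψ i]
    ring

lemma IsWeakGrad.ae_eq {v : Pt → ℝ} {g k : Pt → Fin 2 → ℝ} (hg : IsWeakGrad v g)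
    (hk : IsWeakGrad v k) : g =ᵐ[volume.restrict Om] k := by
  have : ∀ i, (fun z => g z i - k z i) =ᵐ[volume.restrict Om] 0 := fun i =>
    ae_eq_zero_of_integral_testFunctions ((hg.grad_locInt i).sub (hk.grad_locInt i))
      fun ψ hψ => by
        simp only [sub_mul]
        rw [integral_sub (integrable_mul_testFunction (hg.grad_locInt i) hψ)
          (integrable_mul_testFunction (hk.grad_locInt i) hψ), hg.integral_eq ψ hψ i,
          hk.integral_eq ψ hψ i, sub_self]
  filter_upwards [ae_all_iff.2 this] with z hz
  exact funext fun i => sub_eq_zero.1 (hz i)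

lemma IsWeakDiv.ae_eq {u : Pt → Fin 2 → ℝ} {d e : Pt → ℝ} (hd : IsWeakDiv u d)
    (he : IsWeakDiv u e) : d =ᵐ[volume.restrict Om] e := by
  have : (fun z => d z - e z) =ᵐ[volume.restrict Om] 0 :=
    ae_eq_zero_of_integral_testFunctions (hd.div_locInt.sub he.div_locInt) fun ψ hψ => by
      simp only [sub_mul]
      rw [integral_sub (integrable_mul_testFunction hd.div_locInt hψ)
        (integrable_mul_testFunction he.div_locInt hψ), hd.integral_eq ψ hψ,
        he.integral_eq ψ hψ, sub_self]
  filter_upwards [this] with z hz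
  exact sub_eq_zero.1 hz

lemma SmoothOnOm.continuousOn_grad {F : Pt → ℝ} (hF : SmoothOnOm F) (i : Fin 2) :
    ContinuousOn (fun z => grad F z i) Om := by
  rw [isOpen_Om.continuousOn_iff]
  intro z hz
  obtain ⟨p, rfl⟩ := exists_cov_eq z
  rw [← isOpenQuotientMap_cov.continuousAt_comp_iff]
  have hc : ContinuousAt (fderiv ℝ (lift F)) p := (hF.contDiffAt hz).continuousAt_fderiv (by simp)
  have e : (fun z => grad F z i) ∘ cov =ᶠ[𝓝 p]
      fun p => ![fderiv ℝ (lift F) p (1, 0), fderiv ℝ (lift F) p (0, 1)] i := by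
    filter_upwards [continuous_cov.continuousAt.preimage_mem_nhds (isOpen_Om.mem_nhds hz)] with q hq
    rw [Function.comp_apply, grad_cov (hF.differentiableAt hq)]
  refine ContinuousAt.congr ?_ e.symm
  fin_cases i
  · exact hc.clm_apply continuousAt_const
  · exact hc.clm_apply continuousAt_const

lemma SmoothOnOm.continuousOn {F : Pt → ℝ} (hF : SmoothOnOm F) : ContinuousOn F Om := by
  rw [isOpen_Om.continuousOn_iff]
  intro z hz
  obtain ⟨p, rfl⟩ := exists_cov_eq z
  rw [← isOpenQuotientMap_cov.continuousAt_comp_iff]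
  exact (hF.contDiffAt hz).continuousAt

/-- The classical gradient is a distributional gradient. -/
lemma SmoothOnOm.isWeakGrad {F : Pt → ℝ} (hF : SmoothOnOm F) : IsWeakGrad F (grad F) where
  locInt := hF.continuousOn.locallyIntegrableOn measurableSet_Om
  grad_locInt i := (hF.continuousOn_grad i).locallyIntegrableOn measurableSet_Om
  integral_eq ψ hψ i := by
    have hsψ := smoothOnOm_of_mem_testFunctions hψ
    have ht : Om.indicator (fun z => F z * ψ z) ∈ testFunctions :=
      indicator_mem_testFunctions (hF.mul hsψ) hψ.2.1.isCompact hψ.2.2 fun z _ hz =>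
        subset_tsupport _ (right_ne_zero_of_mul hz)
    have h0 := integral_grad_eq_zero ht i
    rw [setIntegral_congr_fun measurableSet_Om (g := fun z => F z * grad ψ z i + grad F z i * ψ z)
      fun z hz => by
        simp only [grad_indicator _ hz, hF.grad_mul hsψ hz, mul_comm (ψ z)],
      integral_add
        (integrable_mul_grad (hF.continuousOn.locallyIntegrableOn measurableSet_Om) hψ i)
        (integrable_mul_testFunction
          ((hF.continuousOn_grad i).locallyIntegrableOn measurableSet_Om) hψ)] at h0
    linarith


lemma dotProduct_A_mulVec (α r : ℝ) (x : Fin 2 → ℝ) :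
    x ⬝ᵥ (A α r *ᵥ x) = x 0 ^ 2 + r ^ α * x 1 ^ 2 := by
  simp only [A, mulVec_diagonal, dotProduct, Fin.sum_univ_two, cons_val_zero, cons_val_one]
  ring

lemma dotProduct_A_inv_mulVec (α : ℝ) {r : ℝ} (hr : 0 < r) (x : Fin 2 → ℝ) :
    x ⬝ᵥ ((A α r)⁻¹ *ᵥ x) = x 0 ^ 2 + x 1 ^ 2 / r ^ α := by
  have hne : r ^ α ≠ 0 := (Real.rpow_pos_of_pos hr α).ne'
  have h : (A α r)⁻¹ = Matrix.diagonal ![1, (r ^ α)⁻¹] := by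
    refine Matrix.inv_eq_right_inv ?_
    rw [A, diagonal_mul_diagonal, ← diagonal_one]
    congr 1
    funext i
    fin_cases i <;> simp [hne]
  rw [h]
  simp only [mulVec_diagonal, dotProduct, Fin.sum_univ_two, cons_val_zero, cons_val_one]
  ring

lemma abs_mul_le_weighted {s t : ℝ} (hs : 0 < s) (ht : 0 < t) (a b : ℝ) :
    |a * b| ≤ t / 2 * (a ^ 2 / s) + 1 / (2 * t) * (s * b ^ 2) := by
  have hts : 0 < 2 * (t * s) := by positivity
  rw [abs_le]
  constructor
  · have h : t / 2 * (a ^ 2 / s) + 1 / (2 * t) * (s * b ^ 2) + a * b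
        = (t * a + s * b) ^ 2 / (2 * (t * s)) := by
      field_simp
      ring
    have := div_nonneg (sq_nonneg (t * a + s * b)) hts.le
    linarith
  · have h : t / 2 * (a ^ 2 / s) + 1 / (2 * t) * (s * b ^ 2) - a * b
        = (t * a - s * b) ^ 2 / (2 * (t * s)) := by
      field_simp
      ring
    have := div_nonneg (sq_nonneg (t * a - s * b)) hts.le
    linarith

lemma abs_pairing_le (α : ℝ) {r t : ℝ} (hr : 0 < r) (ht : 0 < t) (d w : ℝ) (x g : Fin 2 → ℝ) :
    |d * w + x ⬝ᵥ g| ≤ t / 2 * (d ^ 2 + x ⬝ᵥ ((A α r)⁻¹ *ᵥ x)) +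
      1 / (2 * t) * (g ⬝ᵥ (A α r *ᵥ g) + w ^ 2) := by
  rw [dotProduct_A_mulVec, dotProduct_A_inv_mulVec α hr, dotProduct, Fin.sum_univ_two]
  have h1 := abs_mul_le_weighted one_pos ht d w
  have h2 := abs_mul_le_weighted one_pos ht (x 0) (g 0)
  have h3 := abs_mul_le_weighted (Real.rpow_pos_of_pos hr α) ht (x 1) (g 1)
  have h4 := (abs_add_le (d * w) (x 0 * g 0 + x 1 * g 1)).trans
    (add_le_add_right (abs_add_le (x 0 * g 0) (x 1 * g 1)) _)
  simp only [div_one, one_mul] at h1 h2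
  linarith

lemma eq_zero_of_forall_abs_le_div {c D : ℝ} (h : ∀ t > 0, |c| ≤ D / t) : c = 0 := by
  by_contra hc
  have hlim : Tendsto (fun t : ℝ => D / t) atTop (𝓝 0) := tendsto_const_nhds.div_atTop tendsto_id
  have := ge_of_tendsto hlim ((eventually_gt_atTop 0).mono h)
  exact hc (abs_nonpos_iff.1 this)

/-- A cutoff function of the height, vanishing for `r ≤ ε` and equal to `1` for `r ≥ 2 * ε`. -/
noncomputable def cutoff (ε r : ℝ) : ℝ := Real.smoothTransition (r / ε - 1)

lemma contDiff_cutoff (ε : ℝ) : ContDiff ℝ ∞ (cutoff ε) :=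
  Real.smoothTransition.contDiff.comp ((contDiff_id.div_const ε).sub contDiff_const)

lemma cutoff_eq_zero {ε r : ℝ} (hε : 0 < ε) (h : r ≤ ε) : cutoff ε r = 0 :=
  Real.smoothTransition.zero_of_nonpos (by rw [sub_nonpos, div_le_one hε]; exact h)

lemma cutoff_eq_one {ε r : ℝ} (hε : 0 < ε) (h : 2 * ε ≤ r) : cutoff ε r = 1 :=
  Real.smoothTransition.one_of_one_le (by rw [le_sub_iff_add_le, le_div_iff₀ hε]; linarith)

lemma abs_cutoff_le (ε r : ℝ) : |cutoff ε r| ≤ 1 := by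
  rw [cutoff, abs_of_nonneg (Real.smoothTransition.nonneg _)]
  exact Real.smoothTransition.le_one _

lemma deriv_cutoff_eq_zero {ε r : ℝ} (hε : 0 < ε) (h : 2 * ε < r) : deriv (cutoff ε) r = 0 := by
  have : cutoff ε =ᶠ[𝓝 r] fun _ => 1 :=
    (eventually_gt_nhds h).mono fun s hs => cutoff_eq_one hε hs.le
  rw [this.deriv_eq, deriv_const]

lemma exists_abs_deriv_cutoff_le :
    ∃ C, 0 ≤ C ∧ ∀ ε r : ℝ, 0 < ε → 0 < r → |deriv (cutoff ε) r| ≤ C / ε := by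
  have hc : Continuous (deriv Real.smoothTransition) :=
    (Real.smoothTransition.contDiff (n := 1)).continuous_deriv le_rfl
  obtain ⟨C, hC⟩ := (isCompact_Icc (a := (-1 : ℝ)) (b := 1)).exists_bound_of_continuousOn
    hc.continuousOn
  have hC0 : 0 ≤ C := (norm_nonneg _).trans (hC 0 (by simp))
  refine ⟨C, hC0, fun ε r hε hr => ?_⟩
  by_cases h : 2 * ε < r
  · rw [deriv_cutoff_eq_zero hε h, abs_zero]
    positivity
  · have hd : HasDerivAt (cutoff ε) (deriv Real.smoothTransition (r / ε - 1) * (1 / ε)) r :=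
      (((Real.smoothTransition.contDiff (n := 1)).differentiable one_ne_zero _).hasDerivAt).comp r
        (((hasDerivAt_id r).div_const ε).sub_const 1)
    rw [hd.deriv, abs_mul, abs_of_pos (one_div_pos.2 hε), mul_one_div]
    gcongr
    refine hC _ ⟨?_, ?_⟩
    · have : 0 < r / ε := by positivity
      linarith
    · rw [sub_le_iff_le_add, div_le_iff₀ hε]
      linarith

lemma exists_abs_le_of_mem_CGam {φ : Pt → ℝ} (hφ : φ ∈ CGam) :
    ∃ M, 0 ≤ M ∧ ∀ z ∈ Om, |φ z| ≤ M := by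
  have hc : ContinuousOn (lift φ) (Icc 0 (2 * π) ×ˢ Icc (0 : ℝ) 1) :=
    hφ.1.continuousOn.mono (prod_mono_left (subset_univ _))
  obtain ⟨M, hM⟩ := (isCompact_Icc.prod isCompact_Icc).exists_bound_of_continuousOn hc
  have key : ∀ z ∈ Om, |φ z| ≤ M := by
    intro z hz
    have hmem := (AddCircle.equivIoc (2 * π) 0 z.1).2
    have h := hM (AddCircle.equivIoc (2 * π) 0 z.1, z.2)
      ⟨by simpa using Ioc_subset_Icc_self hmem, Ioo_subset_Icc_self hz.2⟩
    simpa [lift, AddCircle.coe_equivIoc] using h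
  exact ⟨M, (abs_nonneg _).trans (key ((0 : Circ), 1 / 2) (by norm_num [mem_Om])), key⟩

lemma exists_height_le_of_mem_CGam {φ : Pt → ℝ} (hφ : φ ∈ CGam) :
    ∃ b < 1, ∀ z ∈ Om, φ z ≠ 0 → z.2 ≤ b := by
  obtain ⟨-, δ, hδ, h⟩ := hφ
  refine ⟨1 - δ, by linarith, fun z hz hne => ?_⟩
  have hb : z ∈ OmBar := ⟨mem_univ _, Ioo_subset_Icc_self hz.2⟩
  have hd := h z (subset_closure ⟨hb, hne⟩) (z.1, 1) ⟨mem_univ _, rfl⟩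
  rw [Prod.dist_eq, dist_self, max_eq_right dist_nonneg, Real.dist_eq, abs_sub_comm,
    abs_of_pos (sub_pos.2 hz.2.2)] at hd
  linarith

lemma cutoff_mul_mem_testFunctions {φ : Pt → ℝ} (hφ : φ ∈ CGam) {ε : ℝ} (hε : 0 < ε) :
    Om.indicator (fun z => cutoff ε z.2 * φ z) ∈ testFunctions := by
  obtain ⟨b, hb, hφb⟩ := exists_height_le_of_mem_CGam hφ
  refine indicator_mem_testFunctions
    ((smoothOnOm_snd (contDiff_cutoff ε)).mul (smoothOnOm_of_mem_CGam hφ))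
    (K := univ ×ˢ Icc ε b) (isCompact_univ.prod isCompact_Icc)
    (prod_mono_right fun r hr => ⟨hε.trans_le hr.1, hr.2.trans_lt hb⟩) fun z hz hne => ?_
  refine ⟨mem_univ _, ?_, hφb z hz (right_ne_zero_of_mul hne)⟩
  by_contra! hlt
  exact left_ne_zero_of_mul hne (cutoff_eq_zero hε hlt.le)

lemma measureReal_low_le {ε : ℝ} (hε : 0 ≤ ε) :
    ((volume : Measure Pt).restrict Om).real {z | z.2 ≤ ε} ≤ 2 * π * ε := by
  have hm : MeasurableSet {z : Pt | z.2 ≤ ε} := measurableSet_le measurable_snd measurable_const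
  rw [measureReal_restrict_apply hm]
  have hsub : {z : Pt | z.2 ≤ ε} ∩ Om ⊆ univ ×ˢ Ioc 0 ε := fun z hz =>
    ⟨mem_univ _, hz.2.2.1, hz.1⟩
  have hvol : (volume : Measure Pt) (univ ×ˢ Ioc 0 ε) = ENNReal.ofReal (2 * π * ε) := by
    rw [Measure.volume_eq_prod, Measure.prod_prod, AddCircle.measure_univ, Real.volume_Ioc, sub_zero,
      ← ENNReal.ofReal_mul Real.two_pi_pos.le]
  calc (volume : Measure Pt).real ({z : Pt | z.2 ≤ ε} ∩ Om)
      ≤ (volume : Measure Pt).real (univ ×ˢ Ioc 0 ε) :=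
        measureReal_mono hsub (by rw [hvol]; exact ENNReal.ofReal_ne_top)
    _ = 2 * π * ε := by
        rw [Measure.real, hvol, ENNReal.toReal_ofReal (by positivity)]

/-- The flux through the cutoff layer is controlled by the weighted energy of the layer. -/
lemma abs_mul_deriv_cutoff_le {α : ℝ} (hα : 1 ≤ α) {C : ℝ} (hC0 : 0 ≤ C)
    (hC : ∀ ε r : ℝ, 0 < ε → 0 < r → |deriv (cutoff ε) r| ≤ C / ε) {ε r t : ℝ} (hε : 0 < ε)
    (hr : 0 < r) (hr1 : r < 1) (ht : 0 < t) (hrε : r ≤ 2 * ε) (x : Fin 2 → ℝ) :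
    |x 1 * deriv (cutoff ε) r| ≤
      C * (t / 2 * (x ⬝ᵥ ((A α r)⁻¹ *ᵥ x)) + 1 / (t * ε)) := by
  have hpow : r ^ α ≤ 2 * ε := by
    calc r ^ α ≤ r ^ (1 : ℝ) := Real.rpow_le_rpow_of_exponent_ge hr hr1.le hα
      _ ≤ 2 * ε := by rwa [Real.rpow_one]
  have h1 := abs_mul_le_weighted (Real.rpow_pos_of_pos hr α) ht (x 1) (1 / ε)
  have h2 : 1 / (2 * t) * (r ^ α * (1 / ε) ^ 2) ≤ 1 / (t * ε) := by
    calc 1 / (2 * t) * (r ^ α * (1 / ε) ^ 2) ≤ 1 / (2 * t) * (2 * ε * (1 / ε) ^ 2) := by gcongr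
      _ = 1 / (t * ε) := by field_simp
  rw [dotProduct_A_inv_mulVec α hr]
  calc |x 1 * deriv (cutoff ε) r| ≤ |x 1| * (C / ε) := by
        rw [abs_mul]
        exact mul_le_mul_of_nonneg_left (hC ε r hε hr) (abs_nonneg _)
    _ = C * |x 1 * (1 / ε)| := by
        rw [abs_mul, abs_of_pos (one_div_pos.2 hε)]
        ring
    _ ≤ _ := by
        refine mul_le_mul_of_nonneg_left ?_ hC0
        have : 0 ≤ t / 2 * x 0 ^ 2 := by positivity
        linarith

/-- The integral over `Ω` of `div u · φ + u · ∇φ` vanishes for `φ` smooth up to the boundary and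
vanishing near `Γ`. -/
lemma integral_pairing_eq_zero_of_mem_CGam {α : ℝ} (hα : 1 ≤ α) {u : Pt → Fin 2 → ℝ} {d : Pt → ℝ}
    (hd : IsWeakDiv u d)
    (hE : IntegrableOn (fun z => u z ⬝ᵥ ((A α z.2)⁻¹ *ᵥ u z)) Om volume)
    {φ : Pt → ℝ} (hφ : φ ∈ CGam)
    (hint : IntegrableOn (fun z => d z * φ z + u z ⬝ᵥ grad φ z) Om volume) :
    ∫ z in Om, (d z * φ z + u z ⬝ᵥ grad φ z) = 0 := by
  obtain ⟨M, hM0, hM⟩ := exists_abs_le_of_mem_CGam hφ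
  obtain ⟨C, hC0, hC⟩ := exists_abs_deriv_cutoff_le
  set P : Pt → ℝ := fun z => d z * φ z + u z ⬝ᵥ grad φ z with hP
  set E : Pt → ℝ := fun z => u z ⬝ᵥ ((A α z.2)⁻¹ *ᵥ u z)
  have hlow (ε : ℝ) : MeasurableSet {z : Pt | z.2 ≤ ε} :=
    measurableSet_le measurable_snd measurable_const
  have hcutm (ε : ℝ) : Continuous fun z : Pt => cutoff ε z.2 :=
    (contDiff_cutoff ε).continuous.comp continuous_snd
  have hηP (ε : ℝ) : IntegrableOn (fun z => cutoff ε z.2 * P z) Om volume :=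
    Integrable.bdd_mul (c := 1) hint (hcutm ε).aestronglyMeasurable
      (Eventually.of_forall fun z => abs_cutoff_le ε z.2)
  have bound : ∀ t > 0, ∀ ε > 0, |∫ z in Om, cutoff ε z.2 * P z| ≤
      M * C * (t / 2 * (∫ z in Om, {z : Pt | z.2 ≤ 2 * ε}.indicator E z) + 4 * π / t) := by
    intro t ht ε hε
    have hψ := cutoff_mul_mem_testFunctions hφ hε
    set ψ := Om.indicator (fun z => cutoff ε z.2 * φ z)
    have hdot : IntegrableOn (fun z => u z ⬝ᵥ grad ψ z) Om volume := by
      simp only [dotProduct, Fin.sum_univ_two]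
      exact (integrable_mul_grad (hd.locInt 0) hψ 0).add (integrable_mul_grad (hd.locInt 1) hψ 1)
    have hdψ := integrable_mul_testFunction hd.div_locInt hψ
    have hsum : IntegrableOn (fun z => d z * ψ z + u z ⬝ᵥ grad ψ z) Om volume := hdψ.add hdot
    have hzero : ∫ z in Om, (d z * ψ z + u z ⬝ᵥ grad ψ z) = 0 := by
      rw [integral_add hdψ hdot, hd.integral_eq ψ hψ, neg_add_cancel]
    have hpt : ∀ z ∈ Om, d z * ψ z + u z ⬝ᵥ grad ψ z - cutoff ε z.2 * P z =
        φ z * (u z 1 * deriv (cutoff ε) z.2) := by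
      intro z hz
      have h1 : ψ z = cutoff ε z.2 * φ z := indicator_of_mem hz _
      have h2 : ∀ i, grad ψ z i =
          cutoff ε z.2 * grad φ z i + φ z * (![0, deriv (cutoff ε) z.2] : Fin 2 → ℝ) i := by
        intro i
        rw [grad_indicator _ hz, (smoothOnOm_snd (contDiff_cutoff ε)).grad_mul
          (smoothOnOm_of_mem_CGam hφ) hz, grad_snd]
      simp only [hP, dotProduct, Fin.sum_univ_two, h1, h2, cons_val_zero, cons_val_one]
      ring
    have heq : ∫ z in Om, cutoff ε z.2 * P z =
        -∫ z in Om, φ z * (u z 1 * deriv (cutoff ε) z.2) := by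
      rw [← setIntegral_congr_fun measurableSet_Om hpt, integral_sub hsum (hηP ε), hzero]
      ring
    rw [heq, abs_neg]
    have hI1 : Integrable ({z : Pt | z.2 ≤ 2 * ε}.indicator E) (volume.restrict Om) :=
      Integrable.indicator hE (hlow _)
    have hI2 : Integrable ({z : Pt | z.2 ≤ 2 * ε}.indicator fun _ => (1 : ℝ))
        (volume.restrict Om) := (integrable_const _).indicator (hlow _)
    have hI : Integrable (fun z => M * C * (t / 2 * {z : Pt | z.2 ≤ 2 * ε}.indicator E z +
        1 / (t * ε) * {z : Pt | z.2 ≤ 2 * ε}.indicator (fun _ => (1 : ℝ)) z))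
        (volume.restrict Om) := ((hI1.const_mul _).add (hI2.const_mul _)).const_mul _
    calc |∫ z in Om, φ z * (u z 1 * deriv (cutoff ε) z.2)|
        ≤ ∫ z in Om, M * C * (t / 2 * {z : Pt | z.2 ≤ 2 * ε}.indicator E z +
            1 / (t * ε) * {z : Pt | z.2 ≤ 2 * ε}.indicator (fun _ => (1 : ℝ)) z) := by
          rw [← Real.norm_eq_abs]
          refine norm_integral_le_of_norm_le hI ?_
          filter_upwards [ae_restrict_mem measurableSet_Om] with z hz
          rw [Real.norm_eq_abs, abs_mul, mul_assoc M C]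
          by_cases hzε : z.2 ≤ 2 * ε
          · rw [indicator_of_mem (s := {z : Pt | z.2 ≤ 2 * ε}) hzε,
              indicator_of_mem (s := {z : Pt | z.2 ≤ 2 * ε}) hzε, mul_one]
            exact mul_le_mul (hM z hz)
              (abs_mul_deriv_cutoff_le hα hC0 hC hε hz.2.1 hz.2.2 ht hzε (u z)) (abs_nonneg _) hM0
          · rw [indicator_of_notMem (s := {z : Pt | z.2 ≤ 2 * ε}) hzε,
              indicator_of_notMem (s := {z : Pt | z.2 ≤ 2 * ε}) hzε,
              deriv_cutoff_eq_zero hε (not_le.1 hzε)]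
            simp
      _ = M * C * (t / 2 * (∫ z in Om, {z : Pt | z.2 ≤ 2 * ε}.indicator E z) +
            1 / (t * ε) * (volume.restrict Om).real {z : Pt | z.2 ≤ 2 * ε}) := by
          rw [integral_const_mul, integral_add (hI1.const_mul _) (hI2.const_mul _),
            integral_const_mul, integral_const_mul, integral_indicator_const _ (hlow _),
            smul_eq_mul, mul_one]
      _ ≤ M * C * (t / 2 * (∫ z in Om, {z : Pt | z.2 ≤ 2 * ε}.indicator E z) +
            1 / (t * ε) * (2 * π * (2 * ε))) := by
          gcongr
          exact measureReal_low_le (by positivity)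
      _ = _ := by
          congr 2
          field_simp
          ring
  have hε (n : ℕ) : (0 : ℝ) < 1 / ((n : ℝ) + 1) := by positivity
  have hsmall : ∀ z ∈ Om, ∀ᶠ n : ℕ in atTop, 2 * (1 / ((n : ℝ) + 1)) < z.2 := by
    intro z hz
    have hlim : Tendsto (fun n : ℕ => 2 * (1 / ((n : ℝ) + 1))) atTop (𝓝 (2 * 0)) :=
      tendsto_one_div_add_atTop_nhds_zero_nat.const_mul 2
    rw [mul_zero] at hlim
    exact hlim.eventually_lt_const hz.2.1
  have hlimP : Tendsto (fun n : ℕ => ∫ z in Om, cutoff (1 / ((n : ℝ) + 1)) z.2 * P z) atTop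
      (𝓝 (∫ z in Om, P z)) := by
    refine tendsto_integral_of_dominated_convergence (fun z => ‖P z‖)
      (fun n => (hηP _).aestronglyMeasurable) hint.norm (fun n => ?_) ?_
    · refine Eventually.of_forall fun z => ?_
      rw [norm_mul]
      exact mul_le_of_le_one_left (norm_nonneg _) (abs_cutoff_le _ _)
    · filter_upwards [ae_restrict_mem measurableSet_Om] with z hz
      refine tendsto_const_nhds.congr' ?_
      filter_upwards [hsmall z hz] with n hn
      rw [cutoff_eq_one (hε n) hn.le, one_mul]
  have hlimE : Tendsto (fun n : ℕ => ∫ z in Om,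
      {z : Pt | z.2 ≤ 2 * (1 / ((n : ℝ) + 1))}.indicator E z) atTop (𝓝 0) := by
    rw [← integral_zero Pt ℝ (μ := volume.restrict Om)]
    refine tendsto_integral_of_dominated_convergence (fun z => ‖E z‖)
      (fun n => (Integrable.indicator hE (hlow _)).aestronglyMeasurable) hE.norm
      (fun n => Eventually.of_forall fun z => norm_indicator_le_norm_self _ _) ?_
    filter_upwards [ae_restrict_mem measurableSet_Om] with z hz
    refine tendsto_const_nhds.congr' ?_
    filter_upwards [hsmall z hz] with n hn
    exact (indicator_of_notMem (s := {z : Pt | z.2 ≤ 2 * (1 / ((n : ℝ) + 1))})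
      (not_le.2 hn) _).symm
  refine eq_zero_of_forall_abs_le_div (D := M * C * (4 * π)) fun t ht => ?_
  have hR := ((hlimE.const_mul (t / 2)).add_const (4 * π / t)).const_mul (M * C)
  rw [mul_zero, zero_add, ← mul_div_assoc] at hR
  exact le_of_tendsto_of_tendsto' hlimP.abs hR fun n => bound t ht _ (hε n)

lemma IsWeakGrad.aestronglyMeasurable_normSq_density {v : Pt → ℝ} {g : Pt → Fin 2 → ℝ}
    (h : IsWeakGrad v g) (α : ℝ) :
    AEStronglyMeasurable (fun z => g z ⬝ᵥ (A α z.2 *ᵥ g z) + v z ^ 2) (volume.restrict Om) := by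
  simp only [dotProduct_A_mulVec]
  have hr : Measurable fun z : Pt => z.2 ^ α := measurable_snd.pow_const α
  have hg i := (h.grad_locInt i).aestronglyMeasurable
  exact (((hg 0).pow 2).add (hr.aestronglyMeasurable.mul ((hg 1).pow 2))).add
    (h.locInt.aestronglyMeasurable.pow 2)

lemma normSq_density_nonneg (α : ℝ) {r : ℝ} (hr : 0 < r) (w : ℝ) (g : Fin 2 → ℝ) :
    0 ≤ g ⬝ᵥ (A α r *ᵥ g) + w ^ 2 := by
  rw [dotProduct_A_mulVec]
  have := (Real.rpow_pos_of_pos hr α).le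
  positivity

/-- The pairing of `H(div, Ω; w⁻¹)` with `H¹(Ω; w)` is well defined and bounded. -/
lemma integrable_pairing_and_abs_integral_le {α : ℝ} {u : Pt → Fin 2 → ℝ} {d : Pt → ℝ}
    (hd : IsWeakDiv u d) (hd2 : MemLp d 2 (volume.restrict Om))
    (hE : IntegrableOn (fun z => u z ⬝ᵥ ((A α z.2)⁻¹ *ᵥ u z)) Om volume)
    {v : Pt → ℝ} {g : Pt → Fin 2 → ℝ} (hg : IsWeakGrad v g)
    (hN : IntegrableOn (fun z => g z ⬝ᵥ (A α z.2 *ᵥ g z) + v z ^ 2) Om volume) :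
    IntegrableOn (fun z => d z * v z + u z ⬝ᵥ g z) Om volume ∧ ∀ t > 0,
      |∫ z in Om, (d z * v z + u z ⬝ᵥ g z)| ≤
        t / 2 * (∫ z in Om, (d z ^ 2 + u z ⬝ᵥ ((A α z.2)⁻¹ *ᵥ u z))) +
        1 / (2 * t) * ∫ z in Om, (g z ⬝ᵥ (A α z.2 *ᵥ g z) + v z ^ 2) := by
  have hK : Integrable (fun z => d z ^ 2 + u z ⬝ᵥ ((A α z.2)⁻¹ *ᵥ u z)) (volume.restrict Om) :=
    hd2.integrable_sq.add hE
  have hle : ∀ t > 0, ∀ᵐ z ∂((volume : Measure Pt).restrict Om), ‖d z * v z + u z ⬝ᵥ g z‖ ≤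
      t / 2 * (d z ^ 2 + u z ⬝ᵥ ((A α z.2)⁻¹ *ᵥ u z)) +
        1 / (2 * t) * (g z ⬝ᵥ (A α z.2 *ᵥ g z) + v z ^ 2) := by
    intro t ht
    filter_upwards [ae_restrict_mem measurableSet_Om] with z hz
    exact abs_pairing_le α hz.2.1 ht _ _ _ _
  have hm : AEStronglyMeasurable (fun z => d z * v z + u z ⬝ᵥ g z) (volume.restrict Om) := by
    simp only [dotProduct, Fin.sum_univ_two]
    have hu i := (hd.locInt i).aestronglyMeasurable
    have hg' i := (hg.grad_locInt i).aestronglyMeasurable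
    exact (hd2.aestronglyMeasurable.mul hg.locInt.aestronglyMeasurable).add
      (((hu 0).mul (hg' 0)).add ((hu 1).mul (hg' 1)))
  have hbd (t : ℝ) := (hK.const_mul (t / 2)).add (Integrable.const_mul hN (1 / (2 * t)))
  refine ⟨(hbd 1).mono' hm (hle 1 one_pos), fun t ht => ?_⟩
  have h := norm_integral_le_of_norm_le (hbd t) (hle t ht)
  rwa [integral_add' (hK.const_mul _) (Integrable.const_mul hN _), integral_const_mul,
    integral_const_mul] at h

end Cylinder

theorem theorem2p14 (α : ℝ) (hα : 1 ≤ α) (hα' : α < 2)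
    (u : Cylinder.Pt → Fin 2 → ℝ) (hu : u ∈ Cylinder.HDivW α)
    (v : Cylinder.Pt → ℝ) (hv : v ∈ Cylinder.H1GamW α)
    (divu : Cylinder.Pt → ℝ) (hdivu : Cylinder.IsWeakDiv u divu)
    (gradv : Cylinder.Pt → Fin 2 → ℝ) (hgradv : Cylinder.IsWeakGrad v gradv) :
    IntegrableOn (fun z => divu z * v z + u z ⬝ᵥ gradv z) Cylinder.Om volume ∧
      ∫ z in Cylinder.Om, (divu z * v z + u z ⬝ᵥ gradv z) = 0 := by
  open Cylinder Filter in
  obtain ⟨-, hE, d, hd, hd2⟩ := hu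
  obtain ⟨⟨hv2, g, hg, hgE⟩, happ⟩ := hv
  have hdivu2 : MemLp divu 2 (volume.restrict Om) := (memLp_congr_ae (hdivu.ae_eq hd)).2 hd2
  have hgE' : IntegrableOn (fun z => gradv z ⬝ᵥ (A α z.2 *ᵥ gradv z)) Om volume := by
    refine Integrable.congr hgE ?_
    filter_upwards [hgradv.ae_eq hg] with z hz
    rw [hz]
  obtain ⟨hint, -⟩ := integrable_pairing_and_abs_integral_le hdivu hdivu2 hE hgradv
    (hgE'.add hv2.integrable_sq)
  refine ⟨hint, ?_⟩
  set K := ∫ z in Om, (divu z ^ 2 + u z ⬝ᵥ ((A α z.2)⁻¹ *ᵥ u z))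
  refine eq_zero_of_forall_abs_le_div (D := K / 2 + 1 / 2) fun t ht => ?_
  obtain ⟨φ, hφ, G, hG, hGlt⟩ := happ (ENNReal.ofReal (1 / t ^ 2))
    (ENNReal.ofReal_pos.2 (by positivity))
  have hnn : 0 ≤ᵐ[volume.restrict Om] fun z => G z ⬝ᵥ (A α z.2 *ᵥ G z) + (v - φ) z ^ 2 := by
    filter_upwards [ae_restrict_mem measurableSet_Om] with z hz
    exact normSq_density_nonneg α hz.2.1 _ _
  have hGm := hG.aestronglyMeasurable_normSq_density α
  have hGi : IntegrableOn (fun z => G z ⬝ᵥ (A α z.2 *ᵥ G z) + (v - φ) z ^ 2) Om volume :=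
    (lintegral_ofReal_ne_top_iff_integrable hGm hnn).1 (hGlt.trans ENNReal.ofReal_lt_top).ne
  have hGle : ∫ z in Om, (G z ⬝ᵥ (A α z.2 *ᵥ G z) + (v - φ) z ^ 2) ≤ 1 / t ^ 2 := by
    rw [integral_eq_lintegral_of_nonneg_ae hnn hGm]
    exact ENNReal.toReal_le_of_le_ofReal (by positivity) hGlt.le
  obtain ⟨hint', hle⟩ := integrable_pairing_and_abs_integral_le hdivu hdivu2 hE hG hGi
  have hφgrad : gradv - G =ᵐ[volume.restrict Om] grad φ := by
    have h := hgradv.sub hG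
    rw [sub_sub_cancel] at h
    exact h.ae_eq (smoothOnOm_of_mem_CGam hφ).isWeakGrad
  have hsub : (fun z => (divu z * v z + u z ⬝ᵥ gradv z) - (divu z * (v - φ) z + u z ⬝ᵥ G z))
      =ᵐ[volume.restrict Om] fun z => divu z * φ z + u z ⬝ᵥ grad φ z := by
    filter_upwards [hφgrad] with z hz
    rw [← hz, Pi.sub_apply, Pi.sub_apply, dotProduct_sub]
    ring
  have hφ0 := integral_pairing_eq_zero_of_mem_CGam hα hdivu hE hφ
    ((Integrable.sub hint hint').congr hsub)
  rw [← integral_congr_ae hsub, integral_sub hint hint', sub_eq_zero] at hφ0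
  rw [hφ0]
  refine (hle (1 / t) (by positivity)).trans ?_
  calc 1 / t / 2 * K + 1 / (2 * (1 / t)) * ∫ z in Om, (G z ⬝ᵥ (A α z.2 *ᵥ G z) + (v - φ) z ^ 2)
      ≤ 1 / t / 2 * K + 1 / (2 * (1 / t)) * (1 / t ^ 2) := by gcongr
    _ = (K / 2 + 1 / 2) / t := by field_simp
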